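/- Let $n\in\{2,3\}$, let $\Omega\subset\mathbb R^n$ be a bounded convex open set and let $\Gamma\subset\Omega$ be a closed Lipschitz hypersurface, i.e. a nonempty compact set that near each of its points is, in suitable orthonormal coordinates, the graph of a Lipschitz function of $n-1$ variables. Write $d(x)=\operatorname{dist}(x,\Gamma)$ and, for $\alpha\in(-\tfrac12,\tfrac12)$, $$\|u\|_{0,\alpha,\Omega}=\Big(\int_\Omega u^2\,d^{2\alpha}\,dx\Big)^{1/2}.$$ A mesh $\Omega_h$ of $\Omega$ is a finite set of closed cells $K=F_K([0,1]^n)$ (quadrilaterals if $n=2$, hexahedra if $n=3$), where $F_K$ is an injective multilinear (in particular, possibly affine) map on $[0,1]^n$, such that $\overline\Omega=\bigcup_{K\in\Omega_h}K$ and any two different cells are disjoint or meet exactly in a common face, edge or vertex. Let $h_K=\operatorname{diam}K$, let $\rho_K$ be the radius of the largest ball contained in $K$, let $h=\max_{K}h_K/2$ be the maximal radius of the cells, and let $\overline d_K=\max_{x\in K}d(x)$. Given positive constants $\kappa,c,C$, assume that the mesh is shape regular, $\rho_K\le h\le\kappa\rho_K$, and quasi-uniform, $c\,h\le h_K\le C\,h$,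 for all $K\in\Omega_h$. For $\ell\in\mathbb N$ let $$W_h^\ell=\{u_h\in H^1_0(\Omega): u_h|_K\in\mathcal Q^\ell(K)\ \text{ for all } K\in\Omega_h\},$$ where $\mathcal Q^\ell(K)$ consists of the functions $q\circ F_K^{-1}$ with $q$ a polynomial of degree at most $\ell$ in each variable. Define the discrete norm $$\|u_h\|_{h,\alpha}^2=\sum_{K\in\Omega_h}(\overline d_K)^{2\alpha}\,\|u_h\|_{L^2(K)}^2 .$$ Let $t\in[0,\tfrac12)$. Then there are constants $c_1,c_2>0$, depending only on $t$ and on the fixed data $n,\Omega,\Gamma,\ell,\kappa,c,C$ (and not on $\alpha$, on the mesh or on $h$, nor on $u_h$), such that for every $\alpha$ with $|\alpha|<t$, every mesh $\Omega_h$ as above and every $u_h\in W_h^\ell$ one has $\|u_h\|_{0,\alpha,\Omega}<\infty$ and $$c_1\,\|u_h\|_{h,\alpha}\;\le\;\|u_h\|_{0,\alpha,\Omega}\;\le\;c_2\,\|u_h\|_{h,\alpha}.$$ -/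

import Mathlib

open MeasureTheory Filter Topology
open scoped ENNReal ContDiff

noncomputable section

namespace ImmersedFEM

/-- Euclidean space `ℝⁿ`. -/
abbrev E (n : ℕ) : Type := EuclideanSpace ℝ (Fin n)

/-- A closed Lipschitz hypersurface of `ℝⁿ`: a nonempty compact set which, near each of its points,
is the graph of a Lipschitz function over the hyperplane orthogonal to some unit vector `ν`
(only the values of `g` on that hyperplane matter). -/
structure IsClosedLipschitzHypersurface {n : ℕ} (Γ : Set (E n)) : Prop where
  nonempty : Γ.Nonempty
  isCompact : IsCompact Γ
  locally_graph : ∀ x ∈ Γ, ∃ (U : Set (E n)) (ν : E n) (g : E n → ℝ) (L : NNReal),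
    IsOpen U ∧ x ∈ U ∧ ‖ν‖ = 1 ∧ LipschitzWith L g ∧
      Γ ∩ U = {y | inner ℝ ν y = g (y - inner ℝ ν y • ν)} ∩ U

/-! ### Cells -/

/-- The reference cell `[0,1]ⁿ`. -/
def refCell (n : ℕ) : Set (E n) := {x | ∀ i, x i ∈ Set.Icc (0 : ℝ) 1}

/-- The faces of the reference cell, of all dimensions: `s i = some b` fixes the `i`-th coordinate
at `0` (`b = false`) or at `1` (`b = true`), and `s i = none` leaves it free in `[0,1]`. -/
def refFace {n : ℕ} (s : Fin n → Option Bool) : Set (E n) :=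
  {x ∈ refCell n | ∀ i b, s i = some b → x i = if b then 1 else 0}

/-- The `2ⁿ` vertices of a cell, indexed by the vertices of the reference cell. -/
abbrev Vertices (n : ℕ) : Type := (Fin n → Bool) → E n

/-- The multilinear (bilinear for `n = 2`, trilinear for `n = 3`) map that sends the vertices of the
reference cell to the given points. It is affine when these span a parallelepiped. -/
def cellMap {n : ℕ} (p : Vertices n) (x : E n) : E n :=
  ∑ v : Fin n → Bool, (∏ i, if v i then x i else 1 - x i) • p v

/-- The (closed) cell with the given vertices: a quadrilateral for `n = 2`, a hexahedron for
`n = 3`. -/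
def cell {n : ℕ} (p : Vertices n) : Set (E n) := cellMap p '' refCell n

/-- `h_K`, the diameter of the cell. -/
def cellDiam {n : ℕ} (p : Vertices n) : ℝ := Metric.diam (cell p)

/-- `ρ_K`, the radius of the largest ball contained in the cell. -/
def inradius {n : ℕ} (p : Vertices n) : ℝ :=
  sSup {r : ℝ | 0 ≤ r ∧ ∃ x, Metric.closedBall x r ⊆ cell p}

/-- `d̄_K`, the maximal distance to `Γ` of the points of the cell. -/
def maxDist {n : ℕ} (Γ : Set (E n)) (p : Vertices n) : ℝ≥0∞ :=
  ⨆ x ∈ cell p, Metric.infEDist x Γ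

/-! ### Meshes -/

/-- A conforming mesh of `Ω` by finitely many quadrilaterals / hexahedra: the cells are
nondegenerate, they cover the closure of `Ω`, and two different cells that meet do so in a common
proper face (a vertex, an edge or, for `n = 3`, a two-dimensional face). -/
structure Mesh {n : ℕ} (Ω : Set (E n)) where
  cells : Finset (Vertices n)
  injOn : ∀ p ∈ cells, Set.InjOn (cellMap p) (refCell n)
  cover : closure Ω = ⋃ p ∈ cells, cell p
  conforming : ∀ p ∈ cells, ∀ q ∈ cells, p ≠ q → (cell p ∩ cell q).Nonempty →
    ∃ s s' : Fin n → Option Bool, (∃ i, s i ≠ none) ∧ (∃ i, s' i ≠ none) ∧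
      cell p ∩ cell q = cellMap p '' refFace s ∧ cell p ∩ cell q = cellMap q '' refFace s'

/-- `h`, the maximal radius (half of the diameter) of the cells. -/
def Mesh.size {n : ℕ} {Ω : Set (E n)} (M : Mesh Ω) : ℝ :=
  sSup ((fun p => cellDiam p / 2) '' (M.cells : Set (Vertices n)))

/-- Shape regularity: `ρ_K ≤ h ≤ κ ρ_K` for all cells `K`. -/
def Mesh.ShapeRegular {n : ℕ} {Ω : Set (E n)} (M : Mesh Ω) (κ : ℝ) : Prop :=
  ∀ p ∈ M.cells, inradius p ≤ M.size ∧ M.size ≤ κ * inradius p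

/-- Quasi-uniformity: `c h ≤ h_K ≤ C h` for all cells `K`. -/
def Mesh.QuasiUniform {n : ℕ} {Ω : Set (E n)} (M : Mesh Ω) (c C : ℝ) : Prop :=
  ∀ p ∈ M.cells, c * M.size ≤ cellDiam p ∧ cellDiam p ≤ C * M.size

/-! ### Finite element functions -/

/-- `u ∈ H¹₀(Ω)`: `u` is a limit in `H¹(Ω)` of smooth functions with compact support in `Ω`
(`g` is then the weak gradient of `u`). -/
def MemH10 {n : ℕ} (Ω : Set (E n)) (u : E n → ℝ) : Prop :=
  MemLp u 2 (volume.restrict Ω) ∧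
    ∃ g : E n → E n, MemLp g 2 (volume.restrict Ω) ∧
      ∃ φ : ℕ → E n → ℝ,
        (∀ k, ContDiff ℝ ∞ (φ k) ∧ HasCompactSupport (φ k) ∧ tsupport (φ k) ⊆ Ω) ∧
        Tendsto (fun k => eLpNorm (fun x => φ k x - u x) 2 (volume.restrict Ω)) atTop (𝓝 0) ∧
        Tendsto (fun k => eLpNorm (fun x => gradient (φ k) x - g x) 2 (volume.restrict Ω))
          atTop (𝓝 0)

/-- `u|_K ∈ 𝒬^ℓ(K)`: almost everywhere on the cell, `u` is the composition of the inverse of the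
cell map with a polynomial of degree at most `ℓ` in each variable. -/
def MemQ {n : ℕ} (ℓ : ℕ) (p : Vertices n) (u : E n → ℝ) : Prop :=
  ∃ q ∈ MvPolynomial.restrictDegree (Fin n) ℝ ℓ,
    ∀ᵐ y ∂(volume.restrict (cell p)), ∀ x ∈ refCell n, cellMap p x = y →
      u y = MvPolynomial.eval (fun i => x i) q

/-- The finite element space `W_h^ℓ`. -/
def Mesh.femSpace {n : ℕ} {Ω : Set (E n)} (M : Mesh Ω) (ℓ : ℕ) : Set (E n → ℝ) :=
  {u | MemH10 Ω u ∧ ∀ p ∈ M.cells, MemQ ℓ p u}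

/-! ### Norms -/

/-- The weighted norm `‖u‖_{0,α,Ω} = (∫_Ω u² d^{2α})^{1/2}`, `d = dist(·, Γ)`, with values in
`[0, ∞]`. -/
def weightedNorm {n : ℕ} (Γ Ω : Set (E n)) (α : ℝ) (u : E n → ℝ) : ℝ≥0∞ :=
  (∫⁻ x in Ω, ‖u x‖ₑ ^ 2 * Metric.infEDist x Γ ^ (2 * α)) ^ (1 / 2 : ℝ)

/-- The discrete norm `‖u‖_{h,α} = (∑_K d̄_K^{2α} ‖u‖²_{0,K})^{1/2}`, with values in `[0, ∞]`. -/
def Mesh.discreteNorm {n : ℕ} {Ω : Set (E n)} (M : Mesh Ω) (Γ : Set (E n)) (α : ℝ)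
    (u : E n → ℝ) : ℝ≥0∞ :=
  (∑ p ∈ M.cells, maxDist Γ p ^ (2 * α) * eLpNorm u 2 (volume.restrict (cell p)) ^ 2) ^
    (1 / 2 : ℝ)

end ImmersedFEM

end

/-! Equivalence of the weighted norm with the discrete norm on finite element spaces. -/

noncomputable section

namespace ImmersedFEM

/-! The norms are compared cell by cell, with `D` the maximal and `d` the actual distance to `Γ`.
Two scale-invariant facts carry the argument. First, for `γ < 1` the mean of `D ^ γ * d ^ (-γ)` over
a cell is bounded: near `Γ` the distance dominates functions growing at unit speed in one direction,
whose power `-γ` is integrable along that direction (`exists_setLIntegral_maxDist_mul_le`). Second,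
on a cell the supremum of `u²` is at most a constant times its mean. After pulling back, this is
compactness on a finite-dimensional space of polynomials, where the Jacobian determinant is itself a
polynomial of bounded degree (`exists_forall_enorm_sq_mul_volume_le`).

Together they bound the integral of `u² d ^ β` by `D ^ β` times that of `u²` whenever `|β| < γ`. The
reverse inequality follows by duality from the same bound for `-β`, since a weight and its
reciprocal cannot both be small (`lintegral_le_mul_lintegral_mul`). Taking `γ = 2t` and `β = 2α`
gives constants uniform in `α`. -/

/-! ### Integrability of negative powers of the distance to `Γ` -/

lemma lintegral_Icc_rpow_neg_enorm {γ R : ℝ} (hγ1 : γ < 1) (hR : 0 < R) :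
    ∫⁻ x in Set.Icc 0 R, ENNReal.ofReal R ^ γ * ‖x‖ₑ ^ (-γ) = ENNReal.ofReal (R / (1 - γ)) := by
  have hint : IntegrableOn (fun x : ℝ => x ^ (-γ)) (Set.Ioc 0 R) :=
    (intervalIntegrable_iff_integrableOn_Ioc_of_le hR.le).1
      (intervalIntegral.intervalIntegrable_rpow' (by linarith))
  have hval : ∫ x in Set.Ioc 0 R, x ^ (-γ) = R ^ (1 - γ) / (1 - γ) := by
    rw [← intervalIntegral.integral_of_le hR.le, integral_rpow (Or.inl (by linarith))]
    rw [Real.zero_rpow (by linarith)]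
    congr 1 <;> ring_nf
  rw [setLIntegral_congr Ioc_ae_eq_Icc.symm, lintegral_const_mul' _ _ (by finiteness)]
  have : ∫⁻ x in Set.Ioc 0 R, ‖x‖ₑ ^ (-γ) = ∫⁻ x in Set.Ioc 0 R, ENNReal.ofReal (x ^ (-γ)) := by
    refine setLIntegral_congr_fun measurableSet_Ioc fun x hx => ?_
    simp only [Real.enorm_eq_ofReal hx.1.le, ENNReal.ofReal_rpow_of_pos hx.1]
  rw [this, ← ofReal_integral_eq_lintegral_ofReal hint, hval, ENNReal.ofReal_rpow_of_pos hR,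
    ← ENNReal.ofReal_mul (by positivity), ← mul_div_assoc, ← Real.rpow_add hR]
  · simp
  · filter_upwards [ae_restrict_mem measurableSet_Ioc] with x hx
    exact Real.rpow_nonneg hx.1.le _

/-- Where `|a + τ| ≥ R` the integrand is at most one, which costs `2 * R`. The rest lies in two
intervals of length `R` ending at the singularity, each costing `R / (1 - γ)` wherever the
singularity is. -/
lemma lintegral_rpow_neg_enorm_add_le {γ R : ℝ} (hγ0 : 0 ≤ γ) (hγ1 : γ < 1) (hR : 0 < R) (a : ℝ) :
    ∫⁻ τ in Set.Icc (-R) R, ENNReal.ofReal R ^ γ * ‖a + τ‖ₑ ^ (-γ) ≤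
      ENNReal.ofReal (2 / (1 - γ) + 2) * ENNReal.ofReal R := by
  set f : ℝ → ℝ≥0∞ := fun σ => ENNReal.ofReal R ^ γ * ‖σ‖ₑ ^ (-γ) with hf
  have hfm : Measurable f := by fun_prop
  have hpt : ∀ τ, f (a + τ) ≤ (Set.Icc (0 : ℝ) R).indicator f (a + τ) +
      (Set.Icc (0 : ℝ) R).indicator f (-(a + τ)) + 1 := by
    intro τ
    by_cases h1 : a + τ ∈ Set.Icc 0 R
    · rw [Set.indicator_of_mem h1, add_assoc]; exact le_self_add
    by_cases h2 : -(a + τ) ∈ Set.Icc 0 R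
    · have : f (-(a + τ)) = f (a + τ) := by simp only [hf, enorm_neg]
      rw [Set.indicator_of_mem h2, this, add_right_comm]; exact le_add_self
    refine le_trans ?_ le_add_self
    have h3 : R ≤ |a + τ| := by
      by_contra! h
      rw [abs_lt] at h
      rcases le_total 0 (a + τ) with h' | h'
      · exact h1 ⟨h', h.2.le⟩
      · exact h2 ⟨by linarith, by linarith⟩
    have h4 : ENNReal.ofReal R ≤ ‖a + τ‖ₑ := by
      rw [← ofReal_norm]; exact ENNReal.ofReal_le_ofReal h3
    simp only [hf]
    calc _ ≤ ‖a + τ‖ₑ ^ γ * ‖a + τ‖ₑ ^ (-γ) := by gcongr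
      _ ≤ 1 := by rw [ENNReal.rpow_neg]; exact ENNReal.mul_inv_le_one _
  have hind : Measurable ((Set.Icc (0 : ℝ) R).indicator f) := hfm.indicator measurableSet_Icc
  have hI : ∫⁻ σ, (Set.Icc (0 : ℝ) R).indicator f σ = ENNReal.ofReal (R / (1 - γ)) := by
    rw [lintegral_indicator measurableSet_Icc]; exact lintegral_Icc_rpow_neg_enorm hγ1 hR
  calc _ ≤ ∫⁻ τ in Set.Icc (-R) R, ((Set.Icc (0 : ℝ) R).indicator f (a + τ) +
          (Set.Icc (0 : ℝ) R).indicator f (-(a + τ)) + 1) := lintegral_mono hpt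
    _ = (∫⁻ τ in Set.Icc (-R) R, (Set.Icc (0 : ℝ) R).indicator f (a + τ)) +
          (∫⁻ τ in Set.Icc (-R) R, (Set.Icc (0 : ℝ) R).indicator f (-(a + τ))) +
          ∫⁻ τ in Set.Icc (-R) R, 1 := by
        rw [lintegral_add_left (by fun_prop), lintegral_add_left (by fun_prop)]
    _ ≤ (∫⁻ τ, (Set.Icc (0 : ℝ) R).indicator f (a + τ)) +
          (∫⁻ τ, (Set.Icc (0 : ℝ) R).indicator f (-(a + τ))) + ENNReal.ofReal (2 * R) := by
        gcongr
        · exact Measure.restrict_le_self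
        · exact Measure.restrict_le_self
        · rw [setLIntegral_one, Real.volume_Icc]; exact (congrArg _ (by ring)).le
    _ = ENNReal.ofReal (R / (1 - γ)) + ENNReal.ofReal (R / (1 - γ)) + ENNReal.ofReal (2 * R) := by
        rw [lintegral_add_left_eq_self (fun σ => (Set.Icc (0 : ℝ) R).indicator f σ) a,
          lintegral_add_left_eq_self (fun σ => (Set.Icc (0 : ℝ) R).indicator f (-σ)) a,
          lintegral_neg_eq_self (fun σ => (Set.Icc (0 : ℝ) R).indicator f σ), hI]
    _ = _ := by
        have : 0 < 1 - γ := by linarith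
        rw [← ENNReal.ofReal_add (by positivity) (by positivity),
          ← ENNReal.ofReal_add (by positivity) (by positivity),
          ← ENNReal.ofReal_mul (by positivity)]
        congr 1; field_simp; ring

/-- A function that grows at unit speed along the direction `ν` is small only on small sets:
its negative powers of order less than one are integrable on balls, with a scale-invariant bound. -/
lemma setLIntegral_ball_rpow_neg_le {n : ℕ} {γ R : ℝ} (hγ0 : 0 ≤ γ) (hγ1 : γ < 1) (hR : 0 < R)
    {φ : E n → ℝ} (hφ : Measurable φ) {ν : E n} (hν : ‖ν‖ = 1)
    (hshift : ∀ x (τ : ℝ), φ (x + τ • ν) = φ x + τ) (z : E n) :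
    ∫⁻ x in Metric.ball z R, ENNReal.ofReal R ^ γ * ‖φ x‖ₑ ^ (-γ) ≤
      ENNReal.ofReal (2 / (1 - γ) + 2) * volume (Metric.ball z (2 * R)) := by
  set A := ENNReal.ofReal (2 / (1 - γ) + 2)
  set f : E n → ℝ≥0∞ := (Metric.ball z R).indicator
    fun x => ENNReal.ofReal R ^ γ * ‖φ x‖ₑ ^ (-γ) with hf
  have hfm : Measurable f := by
    refine Measurable.indicator ?_ measurableSet_ball
    fun_prop
  -- Averaging over translations along `ν`: by invariance each translate has the same integral,
  -- while exchanging the integrals leaves one-dimensional integrals along `ν`, which vanish for `x`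
  -- outside the doubled ball.
  have h1 : ∫⁻ τ in Set.Icc (-R) R, ∫⁻ x, f (x + τ • ν) = (∫⁻ x, f x) * ENNReal.ofReal (2 * R) := by
    simp_rw [lintegral_add_right_eq_self f]
    rw [lintegral_const, Measure.restrict_apply_univ, Real.volume_Icc]
    congr 2; ring
  have h2 : ∫⁻ τ in Set.Icc (-R) R, ∫⁻ x, f (x + τ • ν) ≤
      A * ENNReal.ofReal R * volume (Metric.ball z (2 * R)) := by
    rw [lintegral_lintegral_swap (by fun_prop), ← setLIntegral_const,
      ← lintegral_indicator measurableSet_ball]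
    refine lintegral_mono fun x => ?_
    by_cases hx : x ∈ Metric.ball z (2 * R)
    · rw [Set.indicator_of_mem hx]
      refine le_trans (lintegral_mono fun τ => ?_)
        (lintegral_rpow_neg_enorm_add_le hγ0 hγ1 hR (φ x))
      rw [hf, ← hshift]
      exact Set.indicator_le_self _ _ _
    · rw [Set.indicator_of_notMem hx, nonpos_iff_eq_zero]
      refine setLIntegral_eq_zero measurableSet_Icc fun τ hτ => ?_
      refine Set.indicator_of_notMem (fun hmem => hx ?_) _
      rw [Metric.mem_ball] at hmem ⊢
      have hτ' : dist x (x + τ • ν) ≤ R := by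
        simpa [dist_eq_norm, norm_smul, hν] using abs_le.2 hτ
      linarith [dist_triangle x (x + τ • ν) z]
  rw [← lintegral_indicator measurableSet_ball]
  have hR0 : ENNReal.ofReal R ≠ 0 := by simpa using hR
  have h3 : (∫⁻ x, f x) * ENNReal.ofReal R ≤
      (A * volume (Metric.ball z (2 * R))) * ENNReal.ofReal R := by
    calc _ ≤ (∫⁻ x, f x) * ENNReal.ofReal (2 * R) := by gcongr; linarith
      _ ≤ _ := by rw [← h1]; refine h2.trans (le_of_eq (by ring))
  exact (ENNReal.mul_le_mul_iff_left hR0 ENNReal.ofReal_ne_top).1 h3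

/-- The distance to a closed Lipschitz hypersurface is bounded from below by finitely many Lipschitz
functions that grow at unit speed along some direction. -/
lemma IsClosedLipschitzHypersurface.exists_finset_le_infEDist {n : ℕ} {Γ : Set (E n)}
    (hΓ : IsClosedLipschitzHypersurface Γ) :
    ∃ (s : Finset (E n)) (φ : E n → E n → ℝ) (ν : E n → E n) (K : E n → NNReal),
      (∀ i ∈ s, 0 < K i ∧ LipschitzWith (K i) (φ i) ∧ ‖ν i‖ = 1 ∧
        ∀ x (τ : ℝ), φ i (x + τ • ν i) = φ i x + τ) ∧
      ∀ x, ∃ i ∈ s, ‖φ i x‖ₑ ≤ K i * Metric.infEDist x Γ := by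
  have hloc : ∀ x : E n, ∃ (U : Set (E n)) (ν : E n) (φ : E n → ℝ) (K : NNReal), x ∈ Γ →
      U ∈ 𝓝 x ∧ ‖ν‖ = 1 ∧ LipschitzWith K φ ∧ (∀ y (τ : ℝ), φ (y + τ • ν) = φ y + τ) ∧
        ∀ y ∈ Γ ∩ U, φ y = 0 := by
    intro x
    by_cases hx : x ∈ Γ
    · obtain ⟨U, ν, g, L, hU, hxU, hν, hg, heq⟩ := hΓ.locally_graph x hx
      have hlin : LipschitzWith ‖innerSL ℝ ν‖₊ (fun y : E n => inner ℝ ν y) :=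
        (innerSL ℝ ν).lipschitz
      have hproj := LipschitzWith.sub (LipschitzWith.id (α := E n))
        (((ContinuousLinearMap.toSpanSingleton ℝ ν).lipschitz).comp hlin)
      -- Here `φ y = ⟨ν, y⟩ - g (y - ⟨ν, y⟩ ν)`. Moving along `ν` does not change the argument of
      -- `g`, hence the unit speed.
      refine ⟨U, ν, _, _, fun _ => ⟨hU.mem_nhds hxU, hν, hlin.sub (hg.comp hproj), ?_, ?_⟩⟩
      · intro y τ
        have : y + τ • ν - (inner ℝ ν y + τ) • ν = y - inner ℝ ν y • ν := by
          rw [add_smul]; abel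
        simp [inner_add_right, inner_smul_right, hν, this]
        ring
      · intro y hy
        rw [heq] at hy
        have := hy.1
        simp only [Set.mem_ofPred_eq] at this
        simpa [sub_eq_zero] using this
    · exact ⟨∅, 0, 0, 0, fun h => absurd h hx⟩
  choose U ν φ K h using hloc
  obtain ⟨s, hs, hcov⟩ := hΓ.isCompact.elim_nhds_subcover U fun x hx => (h x hx).1
  -- Adding one makes the Lipschitz constants positive.
  refine ⟨s, φ, ν, fun i => K i + 1, fun i hi => ⟨by positivity,
    (h i (hs i hi)).2.2.1.weaken le_self_add, (h i (hs i hi)).2.1,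
    (h i (hs i hi)).2.2.2.1⟩, fun x => ?_⟩
  -- The index is chosen by a nearest point `y` of `Γ`, not by `x`: `φ i` vanishes at `y` and is
  -- Lipschitz on the whole space, so `x` may lie outside `U i`.
  obtain ⟨y, hy, hxy⟩ := hΓ.isCompact.exists_infEDist_eq_edist hΓ.nonempty x
  obtain ⟨i, hi, hyi⟩ := Set.mem_iUnion₂.1 (hcov hy)
  refine ⟨i, hi, ?_⟩
  have := ((h i (hs i hi)).2.2.1.weaken (K' := K i + 1) le_self_add) x y
  rwa [(h i (hs i hi)).2.2.2.2 y ⟨hy, hyi⟩, edist_zero_right, ← hxy] at this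

/-- At each point `d ^ (-γ)` is dominated by one of finitely many terms `K i ^ γ * |φ i| ^ (-γ)`,
hence by their sum, and each term obeys the estimate for functions of unit speed. -/
lemma IsClosedLipschitzHypersurface.exists_setLIntegral_ball_infEDist_le {n : ℕ} {Γ : Set (E n)}
    (hΓ : IsClosedLipschitzHypersurface Γ) {γ : ℝ} (hγ0 : 0 ≤ γ) (hγ1 : γ < 1) :
    ∃ A : ℝ≥0∞, A ≠ ⊤ ∧ ∀ (z : E n) (R : ℝ), 0 < R →
      ∫⁻ x in Metric.ball z R, ENNReal.ofReal R ^ γ * Metric.infEDist x Γ ^ (-γ) ≤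
        A * volume (Metric.ball z (2 * R)) := by
  obtain ⟨s, φ, ν, K, hφ, hle⟩ := hΓ.exists_finset_le_infEDist
  refine ⟨∑ i ∈ s, (K i : ℝ≥0∞) ^ γ * ENNReal.ofReal (2 / (1 - γ) + 2),
    ENNReal.sum_ne_top.2 fun i _ => by finiteness, fun z R hR => ?_⟩
  have hpt : ∀ x, Metric.infEDist x Γ ^ (-γ) ≤ ∑ i ∈ s, (K i : ℝ≥0∞) ^ γ * ‖φ i x‖ₑ ^ (-γ) := by
    intro x
    obtain ⟨i, hi, hxi⟩ := hle x
    refine le_trans ?_ (Finset.single_le_sum (f := fun i => (K i : ℝ≥0∞) ^ γ * ‖φ i x‖ₑ ^ (-γ))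
      (fun _ _ => zero_le) hi)
    have h1 : ‖φ i x‖ₑ ^ γ ≤ (K i : ℝ≥0∞) ^ γ * Metric.infEDist x Γ ^ γ := by
      rw [← ENNReal.mul_rpow_of_nonneg _ _ hγ0]; gcongr
    have hK : (K i : ℝ≥0∞) ≠ 0 := by simpa using (hφ i hi).1.ne'
    have hK0 : (K i : ℝ≥0∞) ^ γ ≠ 0 := by simp [ENNReal.rpow_eq_zero_iff, hK]
    have hKt : (K i : ℝ≥0∞) ^ γ ≠ ⊤ := by finiteness
    calc Metric.infEDist x Γ ^ (-γ)
        = (K i : ℝ≥0∞) ^ γ * ((K i : ℝ≥0∞) ^ γ * Metric.infEDist x Γ ^ γ)⁻¹ := by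
          rw [ENNReal.mul_inv (Or.inl hK0) (Or.inl hKt), ← mul_assoc,
            ENNReal.mul_inv_cancel hK0 hKt, one_mul, ENNReal.rpow_neg]
      _ ≤ (K i : ℝ≥0∞) ^ γ * ‖φ i x‖ₑ ^ (-γ) := by
          rw [ENNReal.rpow_neg]; gcongr
  calc _ ≤ ∫⁻ x in Metric.ball z R, ∑ i ∈ s, (K i : ℝ≥0∞) ^ γ *
          (ENNReal.ofReal R ^ γ * ‖φ i x‖ₑ ^ (-γ)) := by
        refine lintegral_mono fun x => ?_
        refine (mul_le_mul_right (hpt x) _).trans (le_of_eq ?_)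
        rw [Finset.mul_sum]
        exact Finset.sum_congr rfl fun i _ => by ring
    _ = ∑ i ∈ s, (K i : ℝ≥0∞) ^ γ *
          ∫⁻ x in Metric.ball z R, ENNReal.ofReal R ^ γ * ‖φ i x‖ₑ ^ (-γ) := by
        rw [lintegral_finsetSum']
        · exact Finset.sum_congr rfl fun i _ => lintegral_const_mul' _ _ (by finiteness)
        · intro i hi
          have := (hφ i hi).2.1.continuous.measurable
          fun_prop
    _ ≤ ∑ i ∈ s, (K i : ℝ≥0∞) ^ γ *
          (ENNReal.ofReal (2 / (1 - γ) + 2) * volume (Metric.ball z (2 * R))) := by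
        refine Finset.sum_le_sum fun i hi => ?_
        gcongr
        exact setLIntegral_ball_rpow_neg_le hγ0 hγ1 hR (hφ i hi).2.1.continuous.measurable
          (hφ i hi).2.2.1 (hφ i hi).2.2.2 z
    _ = _ := by
        rw [Finset.sum_mul]
        exact Finset.sum_congr rfl fun i _ => by ring

/-! ### Polynomials on the reference cell -/

lemma isCompact_refCell (n : ℕ) : IsCompact (refCell n) := by
  have : refCell n = (EuclideanSpace.equiv (Fin n) ℝ).symm ''
      (Set.univ.pi fun _ => Set.Icc (0 : ℝ) 1) := by
    rw [ContinuousLinearEquiv.image_symm_eq_preimage]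
    ext x
    simp only [refCell, Set.mem_preimage, Set.mem_univ_pi]
    rfl
  rw [this]
  exact (isCompact_univ_pi fun _ => isCompact_Icc).image (ContinuousLinearEquiv.continuous _)

/-- The open reference cell. -/
def openRefCell (n : ℕ) : Set (E n) := {x | ∀ i, x i ∈ Set.Ioo (0 : ℝ) 1}

lemma isOpen_openRefCell (n : ℕ) : IsOpen (openRefCell n) := by
  have : openRefCell n = ⋂ i, (fun x : E n => x i) ⁻¹' Set.Ioo (0 : ℝ) 1 := by
    ext x; simp [openRefCell]
  rw [this]
  exact isOpen_iInter_of_finite fun i => isOpen_Ioo.preimage (by fun_prop)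

lemma openRefCell_subset_refCell (n : ℕ) : openRefCell n ⊆ refCell n :=
  fun _ hx i => ⟨(hx i).1.le, (hx i).2.le⟩

lemma continuous_eval_euclidean {n : ℕ} (q : MvPolynomial (Fin n) ℝ) :
    Continuous fun x : E n => MvPolynomial.eval (fun i => x i) q :=
  (MvPolynomial.continuous_eval q).comp (by fun_prop)

lemma eq_zero_of_eval_eq_zero_on_openRefCell {n : ℕ} {q : MvPolynomial (Fin n) ℝ}
    (h : ∀ x ∈ openRefCell n, MvPolynomial.eval (fun i => x i) q = 0) : q = 0 := by
  refine MvPolynomial.funext_set (fun _ => Set.Ioo (0 : ℝ) 1)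
    (fun _ => Set.Ioo_infinite one_pos) fun x hx => ?_
  rw [map_zero]
  exact h (WithLp.toLp 2 x) fun i => hx i trivial

/-- The weighted `L²` norm of a nonzero polynomial with nonzero polynomial weight is positive. -/
lemma integral_refCell_sq_mul_abs_pos {n : ℕ} {q J : MvPolynomial (Fin n) ℝ} (hq : q ≠ 0)
    (hJ : J ≠ 0) :
    0 < ∫ x in refCell n,
      MvPolynomial.eval (fun i => x i) q ^ 2 * |MvPolynomial.eval (fun i => x i) J| := by
  have hqc := continuous_eval_euclidean q
  have hJc := continuous_eval_euclidean J
  have hcont : Continuous fun x : E n =>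
      MvPolynomial.eval (fun i => x i) q ^ 2 * |MvPolynomial.eval (fun i => x i) J| := by fun_prop
  have hnn : ∀ x : E n, 0 ≤
      MvPolynomial.eval (fun i => x i) q ^ 2 * |MvPolynomial.eval (fun i => x i) J| :=
    fun x => by positivity
  refine (integral_nonneg hnn).lt_of_ne' fun h0 => ?_
  have hae := (integral_eq_zero_iff_of_nonneg hnn
    (hcont.continuousOn.integrableOn_compact (isCompact_refCell n))).1 h0
  have hae' := ae_restrict_of_ae_restrict_of_subset (openRefCell_subset_refCell n) hae
  have heq := Measure.eqOn_open_of_ae_eq hae' (isOpen_openRefCell n) hcont.continuousOn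
    continuousOn_const
  refine mul_ne_zero hq hJ (eq_zero_of_eval_eq_zero_on_openRefCell fun x hx => ?_)
  have := heq hx
  simpa using this

/-- Both sides are homogeneous, of degree two in `a` and one in `|b|`. This reduces the claim to a
product of unit spheres, where compactness bounds the left side above and the positive integral on
the right below. -/
lemma exists_forall_sq_mul_integral_le_of_coordinates {n k m : ℕ}
    {Q : (Fin k → ℝ) → E n → ℝ} {P : (Fin m → ℝ) → E n → ℝ}
    (hQ : Continuous Q.uncurry) (hP : Continuous P.uncurry)
    (hQs : ∀ (r : ℝ) a x, Q (r • a) x = r * Q a x) (hPs : ∀ (r : ℝ) a x, P (r • a) x = r * P a x)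
    (hpos : ∀ a b, a ≠ 0 → b ≠ 0 → 0 < ∫ x in refCell n, Q a x ^ 2 * |P b x|) :
    ∃ C : ℝ, 0 < C ∧ ∀ a b, ∀ y ∈ refCell n,
      Q a y ^ 2 * ∫ x in refCell n, |P b x| ≤ C * ∫ x in refCell n, Q a x ^ 2 * |P b x| := by
  have hG : Continuous fun ab : (Fin k → ℝ) × (Fin m → ℝ) =>
      ∫ x in refCell n, Q ab.1 x ^ 2 * |P ab.2 x| := by
    refine continuous_parametric_integral_of_continuous
      (f := fun (ab : (Fin k → ℝ) × (Fin m → ℝ)) x => Q ab.1 x ^ 2 * |P ab.2 x|) ?_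
      (isCompact_refCell n)
    have h1 : Continuous fun z : ((Fin k → ℝ) × (Fin m → ℝ)) × E n => Q z.1.1 z.2 :=
      hQ.comp (by fun_prop : Continuous fun z : ((Fin k → ℝ) × (Fin m → ℝ)) × E n => (z.1.1, z.2))
    have h2 : Continuous fun z : ((Fin k → ℝ) × (Fin m → ℝ)) × E n => P z.1.2 z.2 :=
      hP.comp (by fun_prop : Continuous fun z : ((Fin k → ℝ) × (Fin m → ℝ)) × E n => (z.1.2, z.2))
    exact (h1.pow 2).mul h2.abs
  have hI : Continuous fun b : Fin m → ℝ => ∫ x in refCell n, |P b x| :=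
    continuous_parametric_integral_of_continuous (f := fun b x => |P b x|) hP.abs
      (isCompact_refCell n)
  have hF : Continuous fun z : ((Fin k → ℝ) × (Fin m → ℝ)) × E n =>
      Q z.1.1 z.2 ^ 2 * ∫ x in refCell n, |P z.1.2 x| :=
    ((hQ.comp (by fun_prop : Continuous fun z : ((Fin k → ℝ) × (Fin m → ℝ)) × E n =>
      (z.1.1, z.2))).pow 2).mul (hI.comp (by fun_prop))
  have hS := (isCompact_sphere (0 : Fin k → ℝ) 1).prod (isCompact_sphere (0 : Fin m → ℝ) 1)
  obtain ⟨c, hc, hcG⟩ := hS.exists_forall_le' hG.continuousOn (a := 0) fun ab hab =>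
    hpos ab.1 ab.2 (ne_zero_of_mem_unit_sphere ⟨ab.1, hab.1⟩)
      (ne_zero_of_mem_unit_sphere ⟨ab.2, hab.2⟩)
  obtain ⟨N, hN⟩ := ((hS.prod (isCompact_refCell n)).bddAbove_image hF.continuousOn)
  -- `N` is merely some upper bound; the maximum with one makes the constant positive.
  refine ⟨max N 1 / c, by positivity, fun a b y hy => ?_⟩
  by_cases ha : a = 0
  · have : ∀ x, Q a x = 0 := fun x => by simpa [ha] using hQs 0 0 x
    simp [this]
  by_cases hb : b = 0
  · have : ∀ x, P b x = 0 := fun x => by simpa [hb] using hPs 0 0 x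
    simp [this]
  have ha' : 0 < ‖a‖ := norm_pos_iff.2 ha
  have hb' : 0 < ‖b‖ := norm_pos_iff.2 hb
  set a' := ‖a‖⁻¹ • a with ha'def
  set b' := ‖b‖⁻¹ • b with hb'def
  have hQa : ∀ x, Q a x = ‖a‖ * Q a' x := fun x => by
    rw [← hQs, ha'def, smul_inv_smul₀ ha'.ne']
  have hPb : ∀ x, P b x = ‖b‖ * P b' x := fun x => by
    rw [← hPs, hb'def, smul_inv_smul₀ hb'.ne']
  have hmem : (a', b') ∈ Metric.sphere (0 : Fin k → ℝ) 1 ×ˢ Metric.sphere (0 : Fin m → ℝ) 1 := by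
    constructor
    · simp [ha'def, norm_smul, ha'.ne']
    · simp [hb'def, norm_smul, hb'.ne']
  have h1 : Q a' y ^ 2 * ∫ x in refCell n, |P b' x| ≤ N :=
    hN ⟨((a', b'), y), ⟨hmem, hy⟩, rfl⟩
  have h2 := hcG _ hmem
  simp only at h2
  have e1 : ∫ x in refCell n, |P b x| = ‖b‖ * ∫ x in refCell n, |P b' x| := by
    rw [← integral_const_mul]
    refine integral_congr_ae (.of_forall fun x => ?_)
    simp only [hPb x, abs_mul, abs_norm]
  have e2 : ∫ x in refCell n, Q a x ^ 2 * |P b x| =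
      ‖a‖ ^ 2 * ‖b‖ * ∫ x in refCell n, Q a' x ^ 2 * |P b' x| := by
    rw [← integral_const_mul]
    refine integral_congr_ae (.of_forall fun x => ?_)
    simp only [hPb x, hQa x, abs_mul, abs_norm]
    ring
  rw [e1, e2, hQa y]
  calc (‖a‖ * Q a' y) ^ 2 * (‖b‖ * ∫ x in refCell n, |P b' x|)
      = ‖a‖ ^ 2 * ‖b‖ * (Q a' y ^ 2 * ∫ x in refCell n, |P b' x|) := by ring
    _ ≤ ‖a‖ ^ 2 * ‖b‖ * (max N 1 / c * c) := by
        rw [div_mul_cancel₀ _ hc.ne']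
        gcongr
        exact h1.trans (le_max_left _ _)
    _ ≤ ‖a‖ ^ 2 * ‖b‖ * (max N 1 / c * ∫ x in refCell n, Q a' x ^ 2 * |P b' x|) := by gcongr
    _ = _ := by ring

/-- Inverse inequality between the maximum and weighted `L²` norms of polynomials on the reference
cell, uniformly in the polynomial and in the polynomial weight. -/
lemma exists_forall_sq_mul_integral_le {n : ℕ} (V W : Submodule ℝ (MvPolynomial (Fin n) ℝ))
    [FiniteDimensional ℝ V] [FiniteDimensional ℝ W] :
    ∃ C : ℝ, 0 < C ∧ ∀ q ∈ V, ∀ J ∈ W, ∀ y ∈ refCell n,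
      MvPolynomial.eval (fun i => y i) q ^ 2 *
          ∫ x in refCell n, |MvPolynomial.eval (fun i => x i) J| ≤
        C * ∫ x in refCell n,
          MvPolynomial.eval (fun i => x i) q ^ 2 * |MvPolynomial.eval (fun i => x i) J| := by
  let v (V : Submodule ℝ (MvPolynomial (Fin n) ℝ)) [FiniteDimensional ℝ V] :=
    Module.finBasis ℝ V
  let Q (V : Submodule ℝ (MvPolynomial (Fin n) ℝ)) [FiniteDimensional ℝ V]
      (a : Fin (Module.finrank ℝ V) → ℝ) (x : E n) : ℝ :=
    MvPolynomial.eval (fun i => x i) (((v V).equivFun.symm a : V) : MvPolynomial (Fin n) ℝ)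
  have hQ (V : Submodule ℝ (MvPolynomial (Fin n) ℝ)) [FiniteDimensional ℝ V] :
      Continuous (Q V).uncurry := by
    have : (Q V).uncurry = fun z => ∑ j, z.1 j *
        MvPolynomial.eval (fun i => z.2 i) ((v V j : V) : MvPolynomial (Fin n) ℝ) := by
      ext z
      simp [Q, Function.uncurry, Module.Basis.equivFun_symm_apply, MvPolynomial.smul_eval]
    rw [this]
    refine continuous_finsetSum _ fun j _ => ?_
    exact (by fun_prop : Continuous fun z : (Fin (Module.finrank ℝ V) → ℝ) × E n => z.1 j).mul
      ((continuous_eval_euclidean _).comp continuous_snd)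
  have hs (V : Submodule ℝ (MvPolynomial (Fin n) ℝ)) [FiniteDimensional ℝ V] (r : ℝ) (a) (x : E n) :
      Q V (r • a) x = r * Q V a x := by
    simp only [Q, map_smul, Submodule.coe_smul, MvPolynomial.smul_eval]
  have hne (V : Submodule ℝ (MvPolynomial (Fin n) ℝ)) [FiniteDimensional ℝ V]
      {a : Fin (Module.finrank ℝ V) → ℝ} (ha : a ≠ 0) :
      (((v V).equivFun.symm a : V) : MvPolynomial (Fin n) ℝ) ≠ 0 := by
    rwa [Ne, ZeroMemClass.coe_eq_zero, LinearEquiv.map_eq_zero_iff]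
  obtain ⟨C, hC, h⟩ := exists_forall_sq_mul_integral_le_of_coordinates (hQ V) (hQ W) (hs V) (hs W)
    fun a b ha hb => integral_refCell_sq_mul_abs_pos (hne V ha) (hne W hb)
  refine ⟨C, hC, fun q hq J hJ y hy => ?_⟩
  have := h ((v V).equivFun ⟨q, hq⟩) ((v W).equivFun ⟨J, hJ⟩) y hy
  simpa only [Q, LinearEquiv.symm_apply_apply] using this

/-! ### The cell map and the inverse estimate on cells -/

/-- The Jacobian matrix of the cell map, with polynomial entries. -/
def cellJacobian {n : ℕ} (p : Vertices n) : Matrix (Fin n) (Fin n) (MvPolynomial (Fin n) ℝ) :=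
  fun i j => ∑ v : Fin n → Bool, MvPolynomial.C (p v i) *
    ((∏ k ∈ Finset.univ.erase j, if v k then MvPolynomial.X k else 1 - MvPolynomial.X k) *
      if v j then 1 else -1)

lemma totalDegree_cellJacobian_le {n : ℕ} (p : Vertices n) (i j : Fin n) :
    (cellJacobian p i j).totalDegree ≤ n := by
  refine MvPolynomial.totalDegree_finsetSum_le fun v _ => ?_
  refine (MvPolynomial.totalDegree_mul _ _).trans ?_
  rw [MvPolynomial.totalDegree_C, zero_add]
  refine (MvPolynomial.totalDegree_mul _ _).trans ?_
  have h1 : (if v j then (1 : MvPolynomial (Fin n) ℝ) else -1).totalDegree = 0 := by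
    split_ifs <;> simp
  rw [h1, add_zero]
  refine (MvPolynomial.totalDegree_finsetProd _ _).trans ?_
  calc _ ≤ ∑ k ∈ Finset.univ.erase j, 1 := by
        refine Finset.sum_le_sum fun k _ => ?_
        split_ifs
        · simp
        · exact (MvPolynomial.totalDegree_sub _ _).trans (by simp)
    _ ≤ n := by simp

/-- The bound on the degree is crude, but it places the determinants of all cells in one
finite-dimensional space, which makes the inverse estimate independent of the shape of the cell. -/
lemma det_cellJacobian_mem {n : ℕ} (p : Vertices n) :
    (cellJacobian p).det ∈ MvPolynomial.restrictTotalDegree (Fin n) ℝ (n * n) := by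
  rw [MvPolynomial.mem_restrictTotalDegree, Matrix.det_apply]
  refine MvPolynomial.totalDegree_finsetSum_le fun σ _ => ?_
  rw [Units.smul_def, zsmul_eq_mul]
  refine (MvPolynomial.totalDegree_mul _ _).trans ?_
  have h1 : ((((Equiv.Perm.sign σ : ℤˣ) : ℤ) : MvPolynomial (Fin n) ℝ)).totalDegree = 0 := by
    rw [← map_intCast (MvPolynomial.C (σ := Fin n) (R := ℝ)), MvPolynomial.totalDegree_C]
  rw [h1, zero_add]
  refine (MvPolynomial.totalDegree_finsetProd _ _).trans ?_
  exact (Finset.sum_le_sum fun i _ => totalDegree_cellJacobian_le p _ _).trans (by simp)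

/-- The derivative of the cell map. -/
def cellDeriv {n : ℕ} (p : Vertices n) (x : E n) : E n →L[ℝ] E n :=
  LinearMap.toContinuousLinearMap (Matrix.toEuclideanLin
    ((cellJacobian p).map (MvPolynomial.eval fun i => x i)))

lemma det_cellDeriv {n : ℕ} (p : Vertices n) (x : E n) :
    (cellDeriv p x).det = MvPolynomial.eval (fun i => x i) (cellJacobian p).det := by
  rw [cellDeriv, LinearMap.det_toContinuousLinearMap, Matrix.toEuclideanLin_eq_toLin_orthonormal,
    LinearMap.det_toLin, RingHom.map_det]
  rfl

lemma hasFDerivAt_cellMap {n : ℕ} (p : Vertices n) (x : E n) :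
    HasFDerivAt (cellMap p) (cellDeriv p x) x := by
  rw [← hasFDerivWithinAt_univ, hasFDerivWithinAt_euclidean]
  intro i
  rw [hasFDerivWithinAt_univ]
  have hfac : ∀ (v : Fin n → Bool) (k : Fin n),
      HasFDerivAt (fun y : E n => if v k then y k else 1 - y k)
        ((if v k then (1 : ℝ) else -1) • PiLp.proj (𝕜 := ℝ) 2 (fun _ : Fin n => ℝ) k) x := by
    intro v k
    have h : HasFDerivAt (fun y : E n => y k)
        (PiLp.proj (𝕜 := ℝ) 2 (fun _ : Fin n => ℝ) k) x :=
      (PiLp.proj (𝕜 := ℝ) 2 (fun _ : Fin n => ℝ) k).hasFDerivAt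
    split_ifs
    · simpa using h
    · exact (h.const_sub 1).congr_fderiv (by ext; simp)
  have h := HasFDerivAt.fun_sum (u := Finset.univ) fun (v : Fin n → Bool) _ =>
    ((HasFDerivAt.finsetProd (u := Finset.univ) fun k _ => hfac v k).mul_const (p v i))
  refine (h.congr_fderiv ?_).congr_of_eventuallyEq (.of_forall fun y => ?_)
  · ext w
    simp only [cellDeriv, cellJacobian, _root_.sum_apply,
      _root_.smul_apply, ContinuousLinearMap.comp_apply,
      LinearMap.coe_toContinuousLinearMap', Matrix.toLpLin_apply, Matrix.mulVec, dotProduct,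
      Matrix.map_apply, PiLp.proj_apply, smul_eq_mul, map_sum, map_mul, map_prod,
      MvPolynomial.eval_C, apply_ite (MvPolynomial.eval fun i => x i), MvPolynomial.eval_X,
      map_sub, map_one, map_neg, Finset.sum_mul, Finset.mul_sum]
    rw [Finset.sum_comm]
    refine Finset.sum_congr rfl fun j _ => Finset.sum_congr rfl fun v _ => ?_
    ring
  · simp [cellMap]

lemma continuous_cellMap {n : ℕ} (p : Vertices n) : Continuous (cellMap p) :=
  continuous_iff_continuousAt.2 fun x => (hasFDerivAt_cellMap p x).continuousAt

lemma isCompact_cell {n : ℕ} (p : Vertices n) : IsCompact (cell p) :=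
  (isCompact_refCell n).image (continuous_cellMap p)

lemma measurableSet_cell {n : ℕ} (p : Vertices n) : MeasurableSet (cell p) :=
  (isCompact_cell p).isClosed.measurableSet

lemma setLIntegral_cell_eq {n : ℕ} {p : Vertices n} (hp : Set.InjOn (cellMap p) (refCell n))
    (f : E n → ℝ≥0∞) :
    ∫⁻ y in cell p, f y = ∫⁻ x in refCell n,
      ENNReal.ofReal |MvPolynomial.eval (fun i => x i) (cellJacobian p).det| * f (cellMap p x) := by
  rw [cell, lintegral_image_eq_lintegral_abs_det_fderiv_mul volume
    (isCompact_refCell n).isClosed.measurableSet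
    (fun x _ => (hasFDerivAt_cellMap p x).hasFDerivWithinAt) hp]
  simp_rw [det_cellDeriv]

/-- Inverse estimate: the pointwise values of a function in `𝒬^ℓ(K)` are controlled by its mean
square. The constant does not depend on the shape of the cell. -/
lemma exists_forall_enorm_sq_mul_volume_le (n ℓ : ℕ) :
    ∃ C : ℝ≥0∞, C ≠ ⊤ ∧ ∀ p : Vertices n, Set.InjOn (cellMap p) (refCell n) →
      ∀ u : E n → ℝ, MemQ ℓ p u →
        ∀ᵐ y ∂(volume.restrict (cell p)),
          ‖u y‖ₑ ^ 2 * volume (cell p) ≤ C * ∫⁻ x in cell p, ‖u x‖ₑ ^ 2 := by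
  obtain ⟨C, hC, h⟩ := exists_forall_sq_mul_integral_le
    (MvPolynomial.restrictDegree (Fin n) ℝ ℓ) (MvPolynomial.restrictTotalDegree (Fin n) ℝ (n * n))
  refine ⟨ENNReal.ofReal C, ENNReal.ofReal_ne_top, fun p hp u ⟨q, hq, hu⟩ => ?_⟩
  set J := (cellJacobian p).det with hJ
  have hqc := continuous_eval_euclidean q
  have hJc := continuous_eval_euclidean J
  have hvol : volume (cell p) =
      ENNReal.ofReal (∫ x in refCell n, |MvPolynomial.eval (fun i => x i) J|) := by
    rw [ofReal_integral_eq_lintegral_ofReal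
      (hJc.abs.continuousOn.integrableOn_compact (isCompact_refCell n))
      (.of_forall fun _ => abs_nonneg _), ← setLIntegral_one, setLIntegral_cell_eq hp]
    simp [hJ]
  have hsq : ∫⁻ y in cell p, ‖u y‖ₑ ^ 2 = ENNReal.ofReal (∫ x in refCell n,
      MvPolynomial.eval (fun i => x i) q ^ 2 * |MvPolynomial.eval (fun i => x i) J|) := by
    -- `u` is replaced by the polynomial composed with the inverse map before changing variables, so
    -- that the exceptional null set is discarded on the cell and need not be pulled back.
    set inv := Function.invFunOn (cellMap p) (refCell n) with hinv
    have hcongr : ∫⁻ y in cell p, ‖u y‖ₑ ^ 2 =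
        ∫⁻ y in cell p, ‖MvPolynomial.eval (fun i => inv y i) q‖ₑ ^ 2 := by
      refine lintegral_congr_ae ?_
      filter_upwards [hu, ae_restrict_mem (measurableSet_cell p)] with y hy hmem
      rw [hy (inv y) (Function.invFunOn_mem hmem) (Function.invFunOn_eq hmem)]
    have hint : IntegrableOn (fun x : E n => MvPolynomial.eval (fun i => x i) q ^ 2 *
        |MvPolynomial.eval (fun i => x i) J|) (refCell n) :=
      ((hqc.pow 2).mul hJc.abs).continuousOn.integrableOn_compact (isCompact_refCell n)
    rw [hcongr, setLIntegral_cell_eq hp, ofReal_integral_eq_lintegral_ofReal hint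
      (.of_forall fun _ => by positivity)]
    refine setLIntegral_congr_fun (isCompact_refCell n).isClosed.measurableSet fun x hx => ?_
    simp only
    have hx' : inv (cellMap p x) = x := hp.leftInvOn_invFunOn hx
    rw [hx', mul_comm, ENNReal.ofReal_mul (by positivity), ← Real.enorm_of_nonneg (sq_nonneg _),
      enorm_pow]
  filter_upwards [hu, ae_restrict_mem (measurableSet_cell p)] with y hy hmem
  obtain ⟨x, hx, rfl⟩ := hmem
  rw [hy x hx rfl, hvol, hsq, ← enorm_pow, Real.enorm_of_nonneg (sq_nonneg _),
    ← ENNReal.ofReal_mul (sq_nonneg _), ← ENNReal.ofReal_mul hC.le]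
  exact ENNReal.ofReal_le_ofReal (h q hq J (det_cellJacobian_mem p) x hx)

/-! ### Geometry of the mesh -/

lemma cellDiam_pos {n : ℕ} (hn : 0 < n) {p : Vertices n}
    (hp : Set.InjOn (cellMap p) (refCell n)) : 0 < cellDiam p := by
  have h0 : (0 : E n) ∈ refCell n := fun i => by simp
  have h1 : EuclideanSpace.single (⟨0, hn⟩ : Fin n) (1 : ℝ) ∈ refCell n := fun i => by
    by_cases h : i = ⟨0, hn⟩ <;> simp [h]
  have hne : cellMap p 0 ≠ cellMap p (EuclideanSpace.single (⟨0, hn⟩ : Fin n) (1 : ℝ)) := by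
    intro h
    have := congrArg (fun x : E n => x ⟨0, hn⟩) (hp h0 h1 h)
    simp at this
  exact (dist_pos.2 hne).trans_le
    (Metric.dist_le_diam_of_mem (isCompact_cell p).isBounded ⟨_, h0, rfl⟩ ⟨_, h1, rfl⟩)

lemma Mesh.cellDiam_le {n : ℕ} {Ω : Set (E n)} (M : Mesh Ω) {p : Vertices n} (hp : p ∈ M.cells) :
    cellDiam p ≤ 2 * M.size := by
  have : cellDiam p / 2 ≤ M.size :=
    le_csSup (M.cells.finite_toSet.image _).bddAbove ⟨p, hp, rfl⟩
  linarith

lemma Mesh.size_pos {n : ℕ} (hn : 0 < n) {Ω : Set (E n)} (M : Mesh Ω) {p : Vertices n}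
    (hp : p ∈ M.cells) : 0 < M.size := by
  linarith [cellDiam_pos hn (M.injOn p hp), M.cellDiam_le hp]

lemma Mesh.ShapeRegular.exists_closedBall_subset {n : ℕ} (hn : 0 < n) {Ω : Set (E n)} {M : Mesh Ω}
    {κ : ℝ} (hκ : 0 < κ) (hM : M.ShapeRegular κ) {p : Vertices n} (hp : p ∈ M.cells) :
    ∃ x, Metric.closedBall x (M.size / (2 * κ)) ⊆ cell p := by
  have hs := M.size_pos hn hp
  -- The factor two gives a strict inequality, so attainment of the supremum in `inradius` is not
  -- needed.
  have h1 : M.size / (2 * κ) < inradius p := by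
    have := (hM p hp).2
    rw [div_lt_iff₀ (by positivity)]
    nlinarith
  have hne : {r : ℝ | 0 ≤ r ∧ ∃ x, Metric.closedBall x r ⊆ cell p}.Nonempty :=
    ⟨0, le_rfl, cellMap p 0, by
      rw [Metric.closedBall_zero, Set.singleton_subset_iff]
      exact ⟨0, fun i => by simp, rfl⟩⟩
  obtain ⟨r, ⟨-, x, hx⟩, hr⟩ := exists_lt_of_lt_csSup hne h1
  exact ⟨x, (Metric.closedBall_subset_closedBall hr.le).trans hx⟩

/-- A proper face lies in a coordinate hyperplane, and differentiable maps send null sets to null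
sets. -/
lemma volume_image_refFace_eq_zero {n : ℕ} (p : Vertices n) {s : Fin n → Option Bool}
    (hs : ∃ i, s i ≠ none) : volume (cellMap p '' refFace s) = 0 := by
  obtain ⟨i, hi⟩ := hs
  obtain ⟨b, hb⟩ := Option.ne_none_iff_exists'.1 hi
  refine addHaar_image_eq_zero_of_differentiableOn_of_addHaar_eq_zero _
    (fun x _ => (hasFDerivAt_cellMap p x).differentiableAt.differentiableWithinAt) ?_
  have hsub : refFace s ⊆ (@WithLp.ofLp 2 (Fin n → ℝ)) ⁻¹' {f | f i = if b then 1 else 0} :=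
    fun x hx => hx.2 i b hb
  refine measure_mono_null hsub ?_
  rw [(PiLp.volume_preserving_ofLp (Fin n)).measure_preimage
    (measurableSet_eq_fun (measurable_pi_apply i) measurable_const).nullMeasurableSet]
  exact Measure.pi_hyperplane (fun _ => volume) i _

lemma Mesh.aedisjoint {n : ℕ} {Ω : Set (E n)} (M : Mesh Ω) :
    (M.cells : Set (Vertices n)).Pairwise (Function.onFun (AEDisjoint volume) cell) := by
  intro p hp q hq hpq
  rcases Set.eq_empty_or_nonempty (cell p ∩ cell q) with h | h
  · simp [Function.onFun, AEDisjoint, h]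
  · obtain ⟨s, -, hs, -, h1, -⟩ := M.conforming p hp q hq hpq h
    rw [Function.onFun, AEDisjoint, h1]
    exact volume_image_refFace_eq_zero p hs

/-- The cells cover the closure of `Ω`, and the frontier of a convex set is null. -/
lemma Mesh.ae_eq_iUnion {n : ℕ} {Ω : Set (E n)} (M : Mesh Ω) (hΩ : Convex ℝ Ω) :
    Ω =ᵐ[volume] ⋃ p ∈ M.cells, cell p := by
  rw [← M.cover]
  exact (closure_ae_eq_of_null_frontier (hΩ.addHaar_frontier volume)).symm

lemma Mesh.setLIntegral_eq_sum {n : ℕ} {Ω : Set (E n)} (M : Mesh Ω) (hΩ : Convex ℝ Ω)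
    (f : E n → ℝ≥0∞) : ∫⁻ x in Ω, f x = ∑ p ∈ M.cells, ∫⁻ x in cell p, f x := by
  rw [setLIntegral_congr (M.ae_eq_iUnion hΩ), lintegral_biUnion_finset₀ M.aedisjoint
    fun p _ => (measurableSet_cell p).nullMeasurableSet]

lemma Mesh.restrict_cell_le {n : ℕ} {Ω : Set (E n)} (M : Mesh Ω) (hΩ : Convex ℝ Ω) {p : Vertices n}
    (hp : p ∈ M.cells) : (volume : Measure (E n)).restrict (cell p) ≤ volume.restrict Ω := by
  rw [Measure.restrict_congr_set (M.ae_eq_iUnion hΩ)]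
  exact Measure.restrict_mono (Set.subset_biUnion_of_mem (u := cell) hp) le_rfl

/-! ### The weight on a single cell -/

lemma infEDist_le_maxDist {n : ℕ} (Γ : Set (E n)) {p : Vertices n} {x : E n} (hx : x ∈ cell p) :
    Metric.infEDist x Γ ≤ maxDist Γ p :=
  le_iSup₂ (f := fun x _ => Metric.infEDist x Γ) x hx

lemma maxDist_le_add {n : ℕ} (Γ : Set (E n)) {p : Vertices n} {x : E n} (hx : x ∈ cell p) {R : ℝ}
    (hR : cellDiam p ≤ R) : maxDist Γ p ≤ Metric.infEDist x Γ + ENNReal.ofReal R := by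
  refine iSup₂_le fun y hy => (Metric.infEDist_le_infEDist_add_edist (y := x)).trans ?_
  gcongr
  rw [edist_dist]
  exact ENNReal.ofReal_le_ofReal
    ((Metric.dist_le_diam_of_mem (isCompact_cell p).isBounded hy hx).trans hR)

lemma maxDist_ne_top {n : ℕ} {Γ : Set (E n)} (hΓ : Γ.Nonempty) (p : Vertices n) :
    maxDist Γ p ≠ ⊤ := by
  have hx : cellMap p 0 ∈ cell p := ⟨0, fun i => by simp, rfl⟩
  exact ne_top_of_le_ne_top (ENNReal.add_ne_top.2 ⟨Metric.infEDist_ne_top hΓ, ENNReal.ofReal_ne_top⟩)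
    (maxDist_le_add Γ hx le_rfl)

/-- The cell lies in a ball of radius comparable to `M.size` and, by shape regularity, contains
another such ball, so the estimate on balls passes to cells. -/
lemma IsClosedLipschitzHypersurface.exists_setLIntegral_cell_le {n : ℕ} (hn : 0 < n)
    {Γ : Set (E n)} (hΓ : IsClosedLipschitzHypersurface Γ) {κ : ℝ} (hκ : 0 < κ) {γ : ℝ}
    (hγ0 : 0 ≤ γ) (hγ1 : γ < 1) :
    ∃ A : ℝ≥0∞, A ≠ ⊤ ∧ ∀ {Ω : Set (E n)} (M : Mesh Ω), M.ShapeRegular κ → ∀ p ∈ M.cells,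
      ∫⁻ x in cell p, ENNReal.ofReal (3 * M.size) ^ γ * Metric.infEDist x Γ ^ (-γ) ≤
        A * volume (cell p) := by
  obtain ⟨A, hA, h⟩ := hΓ.exists_setLIntegral_ball_infEDist_le hγ0 hγ1
  -- With `h = M.size`, `12 * κ` is the ratio of the doubled outer radius `6h` to the inner radius
  -- `h / (2κ)`. The outer radius `3h` exceeds the bound `2h` on the diameter because the ball is
  -- open.
  refine ⟨A * ENNReal.ofReal ((12 * κ) ^ n), by finiteness, fun {Ω} M hM p hp => ?_⟩
  have hs := M.size_pos hn hp
  obtain ⟨y, hy⟩ := hM.exists_closedBall_subset hn hκ hp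
  have hz : cellMap p 0 ∈ cell p := ⟨0, fun i => by simp, rfl⟩
  have hsub : cell p ⊆ Metric.ball (cellMap p 0) (3 * M.size) := fun x hx => by
    have h1 := Metric.dist_le_diam_of_mem (isCompact_cell p).isBounded hx hz
    have h2 := M.cellDiam_le hp
    rw [cellDiam] at h2
    rw [Metric.mem_ball]
    linarith
  refine (lintegral_mono_set hsub).trans ((h _ _ (by positivity)).trans ?_)
  rw [mul_assoc]
  gcongr
  have e : 2 * (3 * M.size) = 12 * κ * (M.size / (2 * κ)) := by field_simp; ring
  rw [e, Measure.addHaar_ball_mul_of_pos _ _ (by positivity), finrank_euclideanSpace_fin,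
    ← Measure.addHaar_ball_center volume y]
  gcongr
  exact Metric.ball_subset_closedBall.trans hy

lemma Mesh.ShapeRegular.volume_cell_pos {n : ℕ} (hn : 0 < n) {Ω : Set (E n)} {M : Mesh Ω}
    {κ : ℝ} (hκ : 0 < κ) (hM : M.ShapeRegular κ) {p : Vertices n} (hp : p ∈ M.cells) :
    0 < volume (cell p) := by
  obtain ⟨y, hy⟩ := hM.exists_closedBall_subset hn hκ hp
  have hs := M.size_pos hn hp
  exact (Metric.measure_closedBall_pos volume y (by positivity)).trans_le (measure_mono hy)

lemma volume_cell_ne_top {n : ℕ} (p : Vertices n) : volume (cell p) ≠ ⊤ :=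
  (isCompact_cell p).measure_lt_top.ne

/-- Otherwise `d ^ (-1/2)` would be infinite on a cell of positive volume, against its
integrability. -/
lemma IsClosedLipschitzHypersurface.maxDist_ne_zero {n : ℕ} (hn : 0 < n)
    {Γ : Set (E n)} (hΓ : IsClosedLipschitzHypersurface Γ) {κ : ℝ} (hκ : 0 < κ)
    {Ω : Set (E n)} {M : Mesh Ω} (hM : M.ShapeRegular κ) {p : Vertices n} (hp : p ∈ M.cells) :
    maxDist Γ p ≠ 0 := by
  intro h0
  obtain ⟨A, hA, h⟩ := hΓ.exists_setLIntegral_cell_le hn hκ (γ := 1 / 2) (by norm_num) (by norm_num)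
  have hs := M.size_pos hn hp
  have h1 : ∫⁻ x in cell p, ENNReal.ofReal (3 * M.size) ^ (1 / 2 : ℝ) *
      Metric.infEDist x Γ ^ (-(1 / 2) : ℝ) = ∫⁻ _ in cell p, ⊤ := by
    refine setLIntegral_congr_fun (measurableSet_cell p) fun x hx => ?_
    have hd : Metric.infEDist x Γ = 0 := le_antisymm (h0 ▸ infEDist_le_maxDist Γ hx) bot_le
    have hR : ENNReal.ofReal (3 * M.size) ^ (1 / 2 : ℝ) ≠ 0 := by
      rw [Ne, ENNReal.rpow_eq_zero_iff]
      simp [hs]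
    rw [hd, ENNReal.zero_rpow_of_neg (by norm_num), ENNReal.mul_top hR]
  have h2 := h M hM p hp
  rw [h1, setLIntegral_const, ENNReal.top_mul (hM.volume_cell_pos hn hκ hp).ne', top_le_iff] at h2
  exact ENNReal.mul_ne_top hA (volume_cell_ne_top p) h2

/-- Since `D ≤ d + 3h` with `h = M.size`, and powers of order `γ ≤ 1` are subadditive, the integrand
is at most `1 + (3h) ^ γ * d ^ (-γ)`. Cells near `Γ` and far from it are thus treated alike. -/
lemma IsClosedLipschitzHypersurface.exists_setLIntegral_maxDist_mul_le {n : ℕ} (hn : 0 < n)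
    {Γ : Set (E n)} (hΓ : IsClosedLipschitzHypersurface Γ) {κ : ℝ} (hκ : 0 < κ) {γ : ℝ}
    (hγ0 : 0 ≤ γ) (hγ1 : γ < 1) :
    ∃ A : ℝ≥0∞, A ≠ ⊤ ∧ ∀ {Ω : Set (E n)} (M : Mesh Ω), M.ShapeRegular κ → ∀ p ∈ M.cells,
      ∫⁻ x in cell p, maxDist Γ p ^ γ * Metric.infEDist x Γ ^ (-γ) ≤ A * volume (cell p) := by
  obtain ⟨A, hA, h⟩ := hΓ.exists_setLIntegral_cell_le hn hκ hγ0 hγ1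
  refine ⟨1 + A, by finiteness, fun {Ω} M hM p hp => ?_⟩
  have hs := M.size_pos hn hp
  calc _ ≤ ∫⁻ x in cell p,
          (1 + ENNReal.ofReal (3 * M.size) ^ γ * Metric.infEDist x Γ ^ (-γ)) := by
        refine setLIntegral_mono' (measurableSet_cell p) fun x hx => ?_
        calc _ ≤ (Metric.infEDist x Γ ^ γ + ENNReal.ofReal (3 * M.size) ^ γ) *
                Metric.infEDist x Γ ^ (-γ) := by
              gcongr
              refine le_trans ?_ (ENNReal.rpow_add_le_add_rpow _ _ hγ0 hγ1.le)
              gcongr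
              exact maxDist_le_add Γ hx (by linarith [M.cellDiam_le hp])
          _ ≤ _ := by
              rw [add_mul]
              gcongr
              rw [ENNReal.rpow_neg]
              exact ENNReal.mul_inv_le_one _
    _ ≤ _ := by
        rw [lintegral_add_left measurable_const, setLIntegral_one, add_mul, one_mul]
        gcongr
        exact h M hM p hp

/-! ### Norm equivalence on a single cell -/

/-- As `β + γ > 0`, `d ^ (β + γ) ≤ D ^ (β + γ)`. One weight with the fixed exponent `γ` thus serves
all `β` of either sign, which is the source of uniformity in `α`. -/
lemma rpow_le_rpow_mul_mul_rpow_neg {d D : ℝ≥0∞} (hdD : d ≤ D) (hD0 : D ≠ 0) (hD : D ≠ ⊤)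
    {β γ : ℝ} (hβ : |β| < γ) : d ^ β ≤ D ^ β * (D ^ γ * d ^ (-γ)) := by
  have hβγ : 0 < β + γ := by linarith [(abs_lt.1 hβ).1]
  have hγ : 0 < γ := (abs_nonneg β).trans_lt hβ
  rw [← mul_assoc, ← ENNReal.rpow_add _ _ hD0 hD]
  rcases eq_or_ne d 0 with rfl | hd0
  · rw [ENNReal.zero_rpow_of_neg (neg_lt_zero.2 hγ), ENNReal.mul_top]
    · exact le_top
    · rw [Ne, ENNReal.rpow_eq_zero_iff]
      simp [hD0, hD]
  · have hd : d ≠ ⊤ := ne_top_of_le_ne_top hD hdD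
    calc d ^ β = d ^ (β + γ) * d ^ (-γ) := by
          rw [← ENNReal.rpow_add _ _ hd0 hd]; congr 1; ring
      _ ≤ _ := by gcongr

/-- Either `s * w` or its inverse is at least one. -/
lemma one_le_mul_add_inv_mul_inv {s : ℝ≥0∞} (hs0 : s ≠ 0) (hs : s ≠ ⊤) (w : ℝ≥0∞) :
    1 ≤ s * w + s⁻¹ * w⁻¹ := by
  rcases le_total 1 (s * w) with h | h
  · exact h.trans le_self_add
  · refine le_trans ?_ le_add_self
    rw [← ENNReal.mul_inv (Or.inl hs0) (Or.inl hs)]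
    exact ENNReal.one_le_inv.2 h

/-- On every cell the weight may be replaced by its value at maximal distance, from above. -/
lemma IsClosedLipschitzHypersurface.exists_setLIntegral_cell_sq_mul_le {n : ℕ} (hn : 0 < n)
    {Γ : Set (E n)} (hΓ : IsClosedLipschitzHypersurface Γ) (ℓ : ℕ) {κ : ℝ} (hκ : 0 < κ) {γ : ℝ}
    (hγ0 : 0 ≤ γ) (hγ1 : γ < 1) :
    ∃ B : ℝ≥0∞, B ≠ ⊤ ∧ ∀ {Ω : Set (E n)} (M : Mesh Ω), M.ShapeRegular κ → ∀ p ∈ M.cells,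
      ∀ u, MemQ ℓ p u → ∀ β : ℝ, |β| < γ →
        ∫⁻ x in cell p, ‖u x‖ₑ ^ 2 * Metric.infEDist x Γ ^ β ≤
          B * (maxDist Γ p ^ β * ∫⁻ x in cell p, ‖u x‖ₑ ^ 2) := by
  obtain ⟨A, hA, hw⟩ := hΓ.exists_setLIntegral_maxDist_mul_le hn hκ hγ0 hγ1
  obtain ⟨C, hC, hu⟩ := exists_forall_enorm_sq_mul_volume_le n ℓ
  refine ⟨C * A, by finiteness, fun {Ω} M hM p hp u hup β hβ => ?_⟩
  set D := maxDist Γ p with hDdef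
  set I := ∫⁻ x in cell p, ‖u x‖ₑ ^ 2 with hI
  have hD0 : D ≠ 0 := hΓ.maxDist_ne_zero hn hκ hM hp
  have hD : D ≠ ⊤ := maxDist_ne_top hΓ.nonempty p
  have hV0 := (hM.volume_cell_pos hn hκ hp).ne'
  have hV := volume_cell_ne_top p
  have hDβ : D ^ β ≠ ⊤ := by finiteness
  have hmeas : Measurable fun x : E n => D ^ γ * Metric.infEDist x Γ ^ (-γ) := by fun_prop
  -- The supremum of `u²` is taken out by the inverse estimate and the weight is integrated; the two
  -- volume factors cancel.
  calc ∫⁻ x in cell p, ‖u x‖ₑ ^ 2 * Metric.infEDist x Γ ^ β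
      ≤ ∫⁻ x in cell p, (C * I / volume (cell p) * D ^ β) *
          (D ^ γ * Metric.infEDist x Γ ^ (-γ)) := by
        refine lintegral_mono_ae ?_
        filter_upwards [hu p (M.injOn p hp) u hup, ae_restrict_mem (measurableSet_cell p)]
          with x hx hmem
        rw [mul_assoc]
        gcongr
        · exact (ENNReal.le_div_iff_mul_le (Or.inl hV0) (Or.inl hV)).2 hx
        · exact rpow_le_rpow_mul_mul_rpow_neg (infEDist_le_maxDist Γ hmem) hD0 hD hβ
    _ = (C * I / volume (cell p) * D ^ β) *
          ∫⁻ x in cell p, (D ^ γ * Metric.infEDist x Γ ^ (-γ)) := lintegral_const_mul _ hmeas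
    _ ≤ (C * I / volume (cell p) * D ^ β) * (A * volume (cell p)) := by
        gcongr
        exact hw M hM p hp
    _ = C * A * (D ^ β * I) * (volume (cell p) * (volume (cell p))⁻¹) := by
        rw [div_eq_mul_inv]; ring
    _ = _ := by rw [ENNReal.mul_inv_cancel hV0 hV, mul_one]

/-- A lower bound from upper bounds for a weight and its reciprocal. -/
lemma lintegral_le_mul_lintegral_mul {X : Type*} [MeasurableSpace X] {μ : Measure X}
    {f w : X → ℝ≥0∞} (hf : AEMeasurable f μ) (hw : AEMeasurable w μ) (hI : ∫⁻ x, f x ∂μ ≠ ⊤)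
    {B : ℝ≥0∞} (hB0 : B ≠ 0) (hB : B ≠ ⊤) (h : ∫⁻ x, f x * (w x)⁻¹ ∂μ ≤ B * ∫⁻ x, f x ∂μ) :
    ∫⁻ x, f x ∂μ ≤ 4 * B * ∫⁻ x, f x * w x ∂μ := by
  have h2B0 : 2 * B ≠ 0 := mul_ne_zero two_ne_zero hB0
  have h2B : 2 * B ≠ ⊤ := by finiteness
  set I := ∫⁻ x, f x ∂μ with hIdef
  -- With `s = 2 * B` the reciprocal weight contributes at most `I / 2`, which is absorbed on the
  -- left because `I` is finite.
  have key : I / 2 + I / 2 ≤ 2 * B * ∫⁻ x, f x * w x ∂μ + I / 2 := by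
    rw [ENNReal.add_halves]
    calc I ≤ ∫⁻ x, (2 * B * (f x * w x) + (2 * B)⁻¹ * (f x * (w x)⁻¹)) ∂μ := by
          refine lintegral_mono fun x => ?_
          calc f x = f x * 1 := (mul_one _).symm
            _ ≤ f x * (2 * B * w x + (2 * B)⁻¹ * (w x)⁻¹) := by
                gcongr
                exact one_le_mul_add_inv_mul_inv h2B0 h2B _
            _ = _ := by ring
      _ = 2 * B * ∫⁻ x, f x * w x ∂μ + (2 * B)⁻¹ * ∫⁻ x, f x * (w x)⁻¹ ∂μ := by
          rw [lintegral_add_left' (by fun_prop), lintegral_const_mul' _ _ h2B,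
            lintegral_const_mul' _ _ (ENNReal.inv_ne_top.2 h2B0)]
      _ ≤ 2 * B * ∫⁻ x, f x * w x ∂μ + (2 * B)⁻¹ * (B * I) := by gcongr
      _ = _ := by
          congr 1
          rw [ENNReal.mul_inv (Or.inl two_ne_zero) (Or.inl ENNReal.ofNat_ne_top), div_eq_mul_inv]
          calc 2⁻¹ * B⁻¹ * (B * I) = B⁻¹ * B * (I * 2⁻¹) := by ring
            _ = _ := by rw [ENNReal.inv_mul_cancel hB0 hB, one_mul]
  have hI2 : I / 2 ≠ ⊤ := ENNReal.div_ne_top hI two_ne_zero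
  have h1 := ENNReal.le_of_add_le_add_right hI2 key
  calc I = I / 2 + I / 2 := (ENNReal.add_halves I).symm
    _ ≤ _ := add_le_add h1 h1
    _ = _ := by ring

lemma eLpNorm_two_sq {X : Type*} [MeasurableSpace X] (μ : Measure X) (u : X → ℝ) :
    eLpNorm u 2 μ ^ 2 = ∫⁻ x, ‖u x‖ₑ ^ 2 ∂μ := by
  have h := eLpNorm_nnreal_pow_eq_lintegral (f := u) (μ := μ) (p := 2) two_ne_zero
  simpa only [NNReal.coe_ofNat, ENNReal.coe_ofNat, ENNReal.rpow_ofNat] using h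

/-- Norm equivalence on a single cell, uniformly in the cell, the function and the exponent. -/
lemma IsClosedLipschitzHypersurface.exists_cell_norm_equivalence {n : ℕ} (hn : 0 < n)
    {Γ : Set (E n)} (hΓ : IsClosedLipschitzHypersurface Γ) (ℓ : ℕ) {κ : ℝ} (hκ : 0 < κ) {γ : ℝ}
    (hγ0 : 0 ≤ γ) (hγ1 : γ < 1) :
    ∃ B : ℝ, 0 < B ∧ ∀ {Ω : Set (E n)} (M : Mesh Ω), M.ShapeRegular κ → ∀ p ∈ M.cells,
      ∀ u, MemQ ℓ p u → MemLp u 2 (volume.restrict (cell p)) → ∀ β : ℝ, |β| < γ →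
        (∫⁻ x in cell p, ‖u x‖ₑ ^ 2 * Metric.infEDist x Γ ^ β ≤
          ENNReal.ofReal B * (maxDist Γ p ^ β * ∫⁻ x in cell p, ‖u x‖ₑ ^ 2)) ∧
        (maxDist Γ p ^ β * ∫⁻ x in cell p, ‖u x‖ₑ ^ 2 ≤
          ENNReal.ofReal B * ∫⁻ x in cell p, ‖u x‖ₑ ^ 2 * Metric.infEDist x Γ ^ β) := by
  obtain ⟨B, hB, h⟩ := hΓ.exists_setLIntegral_cell_sq_mul_le hn ℓ hκ hγ0 hγ1
  have hBe : B ≤ ENNReal.ofReal (B.toReal + 1) := by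
    rw [ENNReal.le_ofReal_iff_toReal_le hB (by positivity)]; linarith
  have hb : (0 : ℝ) ≤ B.toReal := ENNReal.toReal_nonneg
  set b := B.toReal + 1 with hbdef
  have hb0 : ENNReal.ofReal b ≠ 0 := by
    rw [Ne, ENNReal.ofReal_eq_zero, not_le]; positivity
  refine ⟨4 * b, by positivity, fun {Ω} M hM p hp u hup hu2 β hβ => ⟨?_, ?_⟩⟩
  · refine (h M hM p hp u hup β hβ).trans ?_
    gcongr
    exact hBe.trans (ENNReal.ofReal_le_ofReal (by linarith))
  · set D := maxDist Γ p
    have hD0 : D ≠ 0 := hΓ.maxDist_ne_zero hn hκ hM hp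
    have hD : D ≠ ⊤ := maxDist_ne_top hΓ.nonempty p
    have hDβ0 (β : ℝ) : D ^ β ≠ 0 := by
      rw [Ne, ENNReal.rpow_eq_zero_iff]; simp [hD0, hD]
    have hDβ (β : ℝ) : D ^ β ≠ ⊤ := by finiteness
    have hDD (β : ℝ) : D ^ β * D ^ (-β) = 1 := by
      rw [← ENNReal.rpow_add _ _ hD0 hD]; simp
    have hI : ∫⁻ x in cell p, ‖u x‖ₑ ^ 2 ≠ ⊤ := by
      rw [← eLpNorm_two_sq]; exact ENNReal.pow_ne_top hu2.2.ne
    have hmu : AEMeasurable (fun x => ‖u x‖ₑ ^ 2) (volume.restrict (cell p)) :=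
      hu2.1.enorm.pow_const 2
    have hinv : ∀ x, (D ^ (-β) * Metric.infEDist x Γ ^ β)⁻¹ =
        D ^ β * Metric.infEDist x Γ ^ (-β) := fun x => by
      rw [ENNReal.mul_inv (Or.inl (hDβ0 _)) (Or.inl (hDβ _)), ← ENNReal.rpow_neg,
        ← ENNReal.rpow_neg, neg_neg]
    -- The upper estimate at `-β` bounds the integral against the reciprocal of `D ^ (-β) * d ^ β`,
    -- as the duality argument requires.
    have hup' := h M hM p hp u hup (-β) (by rwa [abs_neg])
    have hlow := lintegral_le_mul_lintegral_mul hmu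
      (w := fun x => D ^ (-β) * Metric.infEDist x Γ ^ β) (by fun_prop) hI hb0
      ENNReal.ofReal_ne_top (by
        simp_rw [hinv, mul_left_comm _ (D ^ β)]
        rw [lintegral_const_mul' _ _ (hDβ β)]
        calc _ ≤ D ^ β * (B * (D ^ (-β) * ∫⁻ x in cell p, ‖u x‖ₑ ^ 2)) := by gcongr
          _ = B * (D ^ β * D ^ (-β)) * ∫⁻ x in cell p, ‖u x‖ₑ ^ 2 := by ring
          _ ≤ _ := by rw [hDD, mul_one]; gcongr)
    simp_rw [mul_left_comm _ (D ^ (-β))] at hlow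
    rw [lintegral_const_mul' _ _ (hDβ (-β))] at hlow
    calc D ^ β * ∫⁻ x in cell p, ‖u x‖ₑ ^ 2
        ≤ D ^ β * (4 * ENNReal.ofReal b *
          (D ^ (-β) * ∫⁻ x in cell p, ‖u x‖ₑ ^ 2 * Metric.infEDist x Γ ^ β)) := by gcongr
      _ = 4 * ENNReal.ofReal b * (D ^ β * D ^ (-β)) *
          ∫⁻ x in cell p, ‖u x‖ₑ ^ 2 * Metric.infEDist x Γ ^ β := by ring
      _ = _ := by
          rw [hDD, mul_one, ENNReal.ofReal_mul (by norm_num), ENNReal.ofReal_ofNat]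

end ImmersedFEM

end

/-! ### Summation over the cells -/

theorem mainTheorem7 (n : ℕ) (hn : n = 2 ∨ n = 3)
    (Ω Γ : Set (ImmersedFEM.E n))
    (hΩ_open : IsOpen Ω) (hΩ_bdd : Bornology.IsBounded Ω) (hΩ_conv : Convex ℝ Ω)
    (hΓ : ImmersedFEM.IsClosedLipschitzHypersurface Γ) (hΓΩ : Γ ⊆ Ω)
    (ℓ : ℕ) (κ c C : ℝ) (hκ : 0 < κ) (hc : 0 < c) (hC : 0 < C)
    (t : ℝ) (ht : t ∈ Set.Ico (0 : ℝ) (1 / 2)) :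
    ∃ c₁ c₂ : ℝ, 0 < c₁ ∧ 0 < c₂ ∧
      ∀ α : ℝ, |α| < t →
        ∀ M : ImmersedFEM.Mesh Ω, M.ShapeRegular κ → M.QuasiUniform c C →
          ∀ u ∈ M.femSpace ℓ,
            ImmersedFEM.weightedNorm Γ Ω α u < ⊤ ∧
            ENNReal.ofReal c₁ * M.discreteNorm Γ α u ≤ ImmersedFEM.weightedNorm Γ Ω α u ∧
            ImmersedFEM.weightedNorm Γ Ω α u ≤ ENNReal.ofReal c₂ * M.discreteNorm Γ α u := by
  have hn0 : 0 < n := by omega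
  -- The exponent `γ = 2 * t` is below one because `t < 1 / 2`, and it dominates `|2 * α|` for all
  -- admissible `α` at once.
  obtain ⟨B, hB, h⟩ := hΓ.exists_cell_norm_equivalence hn0 ℓ hκ (γ := 2 * t)
    (by linarith [ht.1]) (by linarith [ht.2])
  have hBr : 0 < B ^ (1 / 2 : ℝ) := by positivity
  refine ⟨(B ^ (1 / 2 : ℝ))⁻¹, B ^ (1 / 2 : ℝ), by positivity, hBr, fun α hα M hM _ u hu => ?_⟩
  have hα' : |2 * α| < 2 * t := by rw [abs_mul, abs_two]; linarith
  have hmem : ∀ p ∈ M.cells, MemLp u 2 (volume.restrict (ImmersedFEM.cell p)) := fun p hp =>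
    hu.1.1.mono_measure (M.restrict_cell_le hΩ_conv hp)
  have hcell := fun p (hp : p ∈ M.cells) => h M hM p hp u (hu.2 p hp) (hmem p hp) (2 * α) hα'
  have hBe : ENNReal.ofReal B ^ (1 / 2 : ℝ) = ENNReal.ofReal (B ^ (1 / 2 : ℝ)) :=
    ENNReal.ofReal_rpow_of_pos hB
  have hupper : ImmersedFEM.weightedNorm Γ Ω α u ≤
      ENNReal.ofReal (B ^ (1 / 2 : ℝ)) * M.discreteNorm Γ α u := by
    rw [ImmersedFEM.weightedNorm, ImmersedFEM.Mesh.discreteNorm, ← hBe,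
      ← ENNReal.mul_rpow_of_nonneg _ _ (by norm_num), M.setLIntegral_eq_sum hΩ_conv,
      Finset.mul_sum]
    refine ENNReal.rpow_le_rpow (Finset.sum_le_sum fun p hp => ?_) (by norm_num)
    rw [ImmersedFEM.eLpNorm_two_sq]
    exact (hcell p hp).1
  have hlower : M.discreteNorm Γ α u ≤
      ENNReal.ofReal (B ^ (1 / 2 : ℝ)) * ImmersedFEM.weightedNorm Γ Ω α u := by
    rw [ImmersedFEM.weightedNorm, ImmersedFEM.Mesh.discreteNorm, ← hBe,
      ← ENNReal.mul_rpow_of_nonneg _ _ (by norm_num), M.setLIntegral_eq_sum hΩ_conv,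
      Finset.mul_sum]
    refine ENNReal.rpow_le_rpow (Finset.sum_le_sum fun p hp => ?_) (by norm_num)
    rw [ImmersedFEM.eLpNorm_two_sq]
    exact (hcell p hp).2
  refine ⟨hupper.trans_lt (ENNReal.mul_lt_top ENNReal.ofReal_lt_top ?_), ?_, hupper⟩
  · refine ENNReal.rpow_lt_top_of_nonneg (by norm_num)
      (ENNReal.sum_ne_top.2 fun p hp => ENNReal.mul_ne_top ?_ (ENNReal.pow_ne_top (hmem p hp).2.ne))
    -- For negative `α`, finiteness of `D ^ (2 * α)` requires `D ≠ 0`.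
    have hD0 := hΓ.maxDist_ne_zero hn0 hκ hM hp
    have hD := ImmersedFEM.maxDist_ne_top hΓ.nonempty p
    finiteness
  · have hne : ENNReal.ofReal (B ^ (1 / 2 : ℝ)) ≠ 0 := by
      rw [Ne, ENNReal.ofReal_eq_zero, not_le]; exact hBr
    rw [ENNReal.ofReal_inv_of_pos hBr, mul_comm, ← div_eq_mul_inv]
    exact ENNReal.div_le_of_le_mul' hlower
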